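/- Let $\mathbf M$ be a category with all small limits and colimits, and let $(\mathrm W,\mathrm C,\mathrm F)$ and $(\mathrm W^{\mathcal G},\mathrm C^{\mathcal G},\mathrm F^{\mathcal G})$ be two model structures on $\mathbf M$ (weak equivalences, cofibrations, fibrations) such that $\mathrm W\subseteq \mathrm W^{\mathcal G}$, $\mathrm C^{\mathcal G}\subseteq \mathrm C$ and $\mathrm F^{\mathcal G}\subseteq \mathrm F$. Write $\mathbf M^{\mathcal G}$ for $\mathbf M$ with the second model structure; its fibrant (cofibrant) objects are called $\mathcal G$-fibrant ($\mathcal G$-cofibrant), while "fibrant" and "cofibrant" refer to the first model structure. A simplicial category is a category enriched over simplicial sets whose morphisms $X\to Y$ are identified, compatibly with composition and identities, with the vertices of the simplicial set $\mathrm{Map}(X,Y)$. Two maps $g,h:X\to Y$ of a simplicial category are strictly simplicially homotopic if there is a $1$-simplex of $\mathrm{Map}(X,Y)$ with initial vertex $g$ and final vertex $h$. A simplicial model category is a model category that is also a simplicial category, is tensored and cotensored over simplicial sets, and is such that for every cofibration $A\to B$ and fibration $X\to Y$ the map $\mathrm{Map}(B,X)\to \mathrm{Map}(A,X)\times_{\mathrm{Map}(A,Y)}\mathrm{Map}(B,Y)$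 is a Kan fibration, which is a trivial Kan fibration if $A\to B$ or $X\to Y$ is a weak equivalence. **Proposition 2.1.** Suppose that the $\mathcal G$-cofibrant objects coincide with the cofibrant objects of $\mathbf M$ and that $\mathbf M^{\mathcal G}$ is a simplicial model category. Let $\mathcal N$ be a simplicial category and $T:\mathbf M\to\mathcal N$ a simplicial functor (for the given simplicial structure of $\mathbf M^{\mathcal G}$) with the property that $T$ sends the maps in $\mathrm W$ between fibrant objects to isomorphisms. Let $H^s:\mathcal N\to\mathcal N'$ be a functor such that $H^s(g)=H^s(h)$ whenever $g$ and $h$ are strictly simplicially homotopic maps of $\mathcal N$. Then the composite $H^sT$ sends the maps in $\mathrm W^{\mathcal G}$ between $\mathcal G$-fibrant objects to isomorphisms. -/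

import Mathlib

open CategoryTheory Limits MonoidalCategory HomotopicalAlgebra Simplicial

universe v u u' v'' u''

namespace LLExtension

section ModelStructures

variable {M : Type u} [Category.{v} M]

/-- The class of weak equivalences of a model structure. Model structures are passed explicitly,
because one category carries two of them. -/
def weq (m : ModelCategory M) : MorphismProperty M :=
  @weakEquivalences M _ m.categoryWithWeakEquivalences

/-- The class of cofibrations of a model structure. -/
def cof (m : ModelCategory M) : MorphismProperty M :=
  @cofibrations M _ m.categoryWithCofibrations

/-- The class of fibrations of a model structure. -/
def fib (m : ModelCategory M) : MorphismProperty M :=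
  @fibrations M _ m.categoryWithFibrations

/-- `X` is cofibrant: the map from the initial object to `X` is a cofibration. -/
def IsCofibrantObj (m : ModelCategory M) (X : M) : Prop :=
  letI := m
  IsCofibrant X

/-- `X` is fibrant: the map from `X` to the terminal object is a fibration. -/
def IsFibrantObj (m : ModelCategory M) (X : M) : Prop :=
  letI := m
  IsFibrant X

/-- The model structure `mG` is an `ℓℓ`-extension of the model structure `m` on the same
category: it has more weak equivalences, less cofibrations and less fibrations. -/
structure IsLLExtension (m mG : ModelCategory M) : Prop where
  weq_le : weq m ≤ weq mG
  cof_le : cof mG ≤ cof m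
  fib_le : fib mG ≤ fib m

end ModelStructures

section Simplicial

open SimplicialCategory

variable {M : Type u} [Category.{v} M] [SimplicialCategory M]

/-- The map of simplicial sets `Map(P, Y) ⟶ Map(K, Map(X, Y))` which is induced by a map
`η : K ⟶ Map(X, P)` and composition. -/
noncomputable def tensorComparison {K : SSet.{v}} {X P : M} (η : K ⟶ sHom X P) (Y : M) :
    sHom P Y ⟶ (ihom K).obj (sHom X Y) :=
  MonoidalClosed.curry (η ▷ sHom P Y ≫ sHomComp X P Y)

/-- The map of simplicial sets `Map(X, Q) ⟶ Map(K, Map(X, Y))` which is induced by a map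
`ε : K ⟶ Map(Q, Y)` and composition. -/
noncomputable def cotensorComparison {K : SSet.{v}} {Y Q : M} (ε : K ⟶ sHom Q Y) (X : M) :
    sHom X Q ⟶ (ihom K).obj (sHom X Y) :=
  MonoidalClosed.curry ((β_ K (sHom X Q)).hom ≫ sHom X Q ◁ ε ≫ sHomComp X Q Y)

/-- A trivial fibration of simplicial sets: a map with the right lifting property with respect to
all the boundary inclusions `∂Δ[n] ⟶ Δ[n]`. -/
def trivialKanFibrations : MorphismProperty SSet.{v} :=
  SSet.modelCategoryQuillen.I.rlp

/-- A Kan fibration: a map with the right lifting property with respect to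
all the horn inclusions `Λ[n + 1, k] ⟶ Δ[n + 1]`. -/
def kanFibrations : MorphismProperty SSet.{v} :=
  SSet.modelCategoryQuillen.J.rlp

/-- The pullback-corner map `Map(B, X) ⟶ Map(A, X) ×_{Map(A, Y)} Map(B, Y)` of
`i : A ⟶ B` and `p : X ⟶ Y`. -/
noncomputable def cornerMap {A B X Y : M} (i : A ⟶ B) (p : X ⟶ Y) :
    sHom B X ⟶ pullback (eHomWhiskerLeft SSet.{v} A p) (eHomWhiskerRight SSet.{v} i Y) :=
  pullback.lift (eHomWhiskerRight SSet.{v} i X) (eHomWhiskerLeft SSet.{v} B p)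
    (eHom_whisker_exchange SSet.{v} i p).symm

/-- The model structure `m`, on a category which is enriched over simplicial sets, is that of a
simplicial model category: all tensors and cotensors with simplicial sets exist, and the
pullback-corner map of a cofibration and a fibration is a Kan fibration, which is trivial if one of
the two maps is a weak equivalence. -/
structure IsSimplicialModel (m : ModelCategory M) : Prop where
  tensor (X : M) (K : SSet.{v}) :
    ∃ (P : M) (η : K ⟶ sHom X P), ∀ Y : M, IsIso (tensorComparison η Y)
  cotensor (Y : M) (K : SSet.{v}) :
    ∃ (Q : M) (ε : K ⟶ sHom Q Y), ∀ X : M, IsIso (cotensorComparison ε X)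
  corner {A B X Y : M} (i : A ⟶ B) (p : X ⟶ Y) (hi : cof m i) (hp : fib m p) :
    kanFibrations (cornerMap i p)
  corner_trivial {A B X Y : M} (i : A ⟶ B) (p : X ⟶ Y) (hi : cof m i) (hp : fib m p)
    (h : weq m i ∨ weq m p) : trivialKanFibrations (cornerMap i p)

/-- Two maps `f g : X ⟶ Y` of a simplicial category are strictly simplicially homotopic if there
is a `1`-simplex of `Map(X, Y)` with initial vertex `f` and final vertex `g`. -/
def StrictlyHomotopic {X Y : M} (f g : X ⟶ Y) : Prop :=
  ∃ h : (sHom X Y) _⦋1⦌,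
    (sHom X Y).δ 1 h = homEquiv' X Y f ∧ (sHom X Y).δ 0 h = homEquiv' X Y g

/-- The functor identifies strictly simplicially homotopic maps. -/
def IdentifiesStrictlyHomotopic {N' : Type u''} [Category.{v''} N'] (H : M ⥤ N') : Prop :=
  ∀ ⦃X Y : M⦄ (f g : X ⟶ Y), StrictlyHomotopic f g → H.map f = H.map g

/-- The functor between the underlying categories of a simplicial functor: a map `f : X ⟶ Y`, viewed
as a vertex `𝟙_ SSet ⟶ Map(X, Y)`, is sent to its image under `Map(X, Y) ⟶ Map(T X, T Y)`. -/
noncomputable def underlying {N : Type u'} [Category.{v} N] [SimplicialCategory N]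
    (T : EnrichedFunctor SSet.{v} M N) : M ⥤ N where
  obj X := T.obj X
  map {X Y} f := (eHomEquiv SSet.{v}).symm (eHomEquiv SSet.{v} f ≫ T.map X Y)
  map_id X := by
    rw [eHomEquiv_id, EnrichedFunctor.map_id, ← eHomEquiv_id, Equiv.symm_apply_apply]
  map_comp {X Y Z} f g := by
    apply (eHomEquiv SSet.{v}).injective
    rw [Equiv.apply_symm_apply, eHomEquiv_comp, eHomEquiv_comp, Equiv.apply_symm_apply,
      Equiv.apply_symm_apply, Category.assoc, Category.assoc, EnrichedFunctor.map_comp,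
      tensorHom_comp_tensorHom_assoc]

end Simplicial

end LLExtension

/-! The composite inverts every map that is invertible up to strict homotopy, since a simplicial
functor preserves edges of mapping spaces. In `M^G` a trivial fibration between cofibrant objects
has a section `s`, and `p ≫ s` and the identity agree after composition with `p`; they lie in one
fibre of a trivial Kan fibration and are thus joined by an edge. Dually for trivial cofibrations
between fibrant objects. Factorization gives all `G`-weak equivalences between bifibrant objects
(`isIso_map_of_bifibrant`). Only `G`-fibrancy is given, so the ends are replaced by trivial
fibrations of the first structure from cofibrant objects. These remain fibrations of `M^G`
(`fib_and_weq`), so the replacements are `G`-bifibrant, and `T` inverts them by hypothesis. -/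

namespace LLExtension

/-! ### Edges in the fibres of trivial Kan fibrations -/

section SimplicialSets

/-- The map `∂Δ[1] ⟶ X` with values `a` at the vertex `0` and `b` at the vertex `1`. -/
noncomputable def boundaryDesc {X : SSet.{v}} (a b : X _⦋0⦌) : (∂Δ[1] : SSet.{v}) ⟶ X where
  app Δ := ↾fun x ↦
    if SSet.stdSimplex.asOrderHom x.1 0 = 0 then
      (SSet.const a : (∂Δ[1] : SSet.{v}) ⟶ X).app Δ x
    else (SSet.const b : (∂Δ[1] : SSet.{v}) ⟶ X).app Δ x
  naturality Δ Δ' φ := by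
    ext x
    -- A simplex of `∂Δ[1]` misses a vertex, hence is constant, so its value at `0` determines it
    -- and is preserved by `φ`.
    have key : SSet.stdSimplex.asOrderHom ((∂Δ[1] : SSet.{v}).map φ x).1 0 =
        SSet.stdSimplex.asOrderHom x.1 0 := by
      obtain ⟨j, hj⟩ := (SSet.mem_boundary_iff_notMem_range x.1).1 x.2
      have h0 : SSet.stdSimplex.asOrderHom x.1 0 ≠ j := fun h ↦ hj ⟨0, h⟩
      have h1 : SSet.stdSimplex.asOrderHom x.1 (φ.unop.toOrderHom 0) ≠ j := fun h ↦ hj ⟨_, h⟩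
      change SSet.stdSimplex.asOrderHom x.1 (φ.unop.toOrderHom 0) = _
      lia
    by_cases hx : SSet.stdSimplex.asOrderHom x.1 0 = 0
    · exact (if_pos (key.trans hx)).trans
        ((NatTrans.naturality_apply _ φ x).trans (congrArg (X.map φ) (if_pos hx).symm))
    · exact (if_neg fun h ↦ hx (key.symm.trans h)).trans
        ((NatTrans.naturality_apply _ φ x).trans (congrArg (X.map φ) (if_neg hx).symm))

/-- The face with index `0` omits the vertex `0`, so it is the vertex `1`, where the value is `b`.
-/
lemma ι_zero_boundaryDesc {X : SSet.{v}} (a b : X _⦋0⦌) :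
    SSet.boundary.ι 0 ≫ boundaryDesc a b = SSet.const b := by
  ext Δ x
  exact if_neg (t := (SSet.const a : Δ[0] ⟶ X).app Δ x)
    (Fin.succAbove_ne (0 : Fin 2) (SSet.stdSimplex.asOrderHom x 0))

lemma ι_one_boundaryDesc {X : SSet.{v}} (a b : X _⦋0⦌) :
    SSet.boundary.ι 1 ≫ boundaryDesc a b = SSet.const a := by
  ext Δ x
  have h : (1 : Fin 2).succAbove (SSet.stdSimplex.asOrderHom x 0) ≠ 1 := Fin.succAbove_ne _ _
  exact if_pos (show (1 : Fin 2).succAbove (SSet.stdSimplex.asOrderHom x 0) = 0 by lia)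

/-- Two vertices with the same image under a trivial Kan fibration are joined by an edge. -/
lemma exists_edge_of_trivialKanFibrations {X Y : SSet.{v}} {p : X ⟶ Y}
    (hp : trivialKanFibrations p) (a b : X _⦋0⦌) (h : p.app _ a = p.app _ b) :
    ∃ e : X _⦋1⦌, X.δ 1 e = a ∧ X.δ 0 e = b := by
  have := hp _ (SSet.modelCategoryQuillen.boundary_ι_mem_I 1)
  have sq : CommSq (boundaryDesc a b) (SSet.boundary 1).ι p (SSet.const (p.app _ a)) := ⟨by
    refine SSet.boundary.hom_ext fun i ↦ ?_
    fin_cases i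
    · change (SSet.boundary.ι 0 ≫ boundaryDesc a b ≫ p) = SSet.boundary.ι 0 ≫ _
      rw [← Category.assoc, ι_zero_boundaryDesc, h]
      simp
    · change (SSet.boundary.ι 1 ≫ boundaryDesc a b ≫ p) = SSet.boundary.ι 1 ≫ _
      rw [← Category.assoc, ι_one_boundaryDesc]
      simp⟩
  have vertex (i : Fin 2) :
      X.δ i (SSet.yonedaEquiv sq.lift) = SSet.yonedaEquiv (SSet.boundary.ι i ≫ boundaryDesc a b) := by
    calc _ = SSet.yonedaEquiv (SSet.stdSimplex.δ i ≫ sq.lift) :=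
          (SSet.stdSimplex.yonedaEquiv_δ_comp _ _).symm
      _ = SSet.yonedaEquiv (SSet.boundary.ι i ≫ (SSet.boundary 1).ι ≫ sq.lift) := rfl
      _ = _ := by rw [sq.fac_left]
  refine ⟨SSet.yonedaEquiv sq.lift, ?_, ?_⟩
  · rw [vertex, ι_one_boundaryDesc, SSet.yonedaEquiv_const]
  · rw [vertex, ι_zero_boundaryDesc, SSet.yonedaEquiv_const]

end SimplicialSets

/-! ### Mapping spaces and strict homotopies in a simplicial model category -/

section Simplicial

open SimplicialCategory

variable {M : Type u} [Category.{v} M] [SimplicialCategory M]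

/-- Maps from `K` correspond to global elements of the internal hom. -/
noncomputable def ihomUnitEquiv (K S : SSet.{v}) :
    (K ⟶ S) ≃ (𝟙_ SSet.{v} ⟶ (ihom K).obj S) :=
  ((ρ_ K).symm.homFromEquiv).trans ((ihom.adjunction K).homEquiv _ _)

/-- The universal property of a cotensor. -/
noncomputable def cotensorEquiv {K : SSet.{v}} {Y Q : M} (ε : K ⟶ sHom Q Y) (X : M)
    [IsIso (cotensorComparison ε X)] : (K ⟶ sHom X Y) ≃ (X ⟶ Q) :=
  (ihomUnitEquiv K _).trans
    (((asIso (cotensorComparison ε X)).symm.homToEquiv).trans (eHomEquiv SSet.{v}).symm)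

/-- The universal property of a tensor. -/
noncomputable def tensorEquiv {K : SSet.{v}} {X P : M} (η : K ⟶ sHom X P) (Y : M)
    [IsIso (tensorComparison η Y)] : (K ⟶ sHom X Y) ≃ (P ⟶ Y) :=
  (ihomUnitEquiv K _).trans
    (((asIso (tensorComparison η Y)).symm.homToEquiv).trans (eHomEquiv SSet.{v}).symm)

/-- Mapping spaces out of an initial object are terminal. -/
lemma IsSimplicialModel.nonempty_isTerminal_of_isInitial {m : ModelCategory M}
    (hm : IsSimplicialModel m) {A : M} (hA : IsInitial A) (Y : M) :
    Nonempty (IsTerminal (sHom A Y)) := by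
  -- `A` is initial only for ordinary maps; the cotensor turns maps from `K` to `Map(A, Y)` into
  -- ordinary maps `A ⟶ Q`.
  have (K : SSet.{v}) : Nonempty (Unique (K ⟶ sHom A Y)) := by
    obtain ⟨Q, ε, h⟩ := hm.cotensor Y K
    have := h A
    let e := cotensorEquiv ε A
    exact ⟨⟨⟨e.symm (hA.to Q)⟩, fun f ↦ e.injective (hA.hom_ext _ _)⟩⟩
  have (K : SSet.{v}) : Unique (K ⟶ sHom A Y) := (this K).some
  exact ⟨IsTerminal.ofUnique _⟩

/-- Mapping spaces into a terminal object are terminal. -/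
lemma IsSimplicialModel.nonempty_isTerminal_of_isTerminal {m : ModelCategory M}
    (hm : IsSimplicialModel m) {B : M} (hB : IsTerminal B) (X : M) :
    Nonempty (IsTerminal (sHom X B)) := by
  have (K : SSet.{v}) : Nonempty (Unique (K ⟶ sHom X B)) := by
    obtain ⟨P, η, h⟩ := hm.tensor X K
    have := h B
    let e := tensorEquiv η B
    exact ⟨⟨⟨e.symm (hB.from P)⟩, fun f ↦ e.injective (hB.hom_ext _ _)⟩⟩
  have (K : SSet.{v}) : Unique (K ⟶ sHom X B) := (this K).some
  exact ⟨IsTerminal.ofUnique _⟩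

/-- Composition with a trivial fibration is a trivial Kan fibration on mapping spaces out of a
cofibrant object. -/
lemma IsSimplicialModel.trivialKanFibrations_whiskerLeft {m : ModelCategory M}
    (hm : IsSimplicialModel m) {Z X Y : M} (hZ : IsCofibrantObj m Z) {p : X ⟶ Y}
    (hp : fib m p) (hw : weq m p) :
    trivialKanFibrations (eHomWhiskerLeft SSet.{v} Z p) := by
  let := m
  obtain ⟨hX⟩ := hm.nonempty_isTerminal_of_isInitial initialIsInitial X
  obtain ⟨hY⟩ := hm.nonempty_isTerminal_of_isInitial initialIsInitial Y
  -- The second projection of the pullback is a base change of this isomorphism, so the corner map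
  -- agrees with `Map(Z, p)` up to isomorphism.
  have : IsIso (eHomWhiskerLeft SSet.{v} (⊥_ M) p) := isIso_of_isTerminal hX hY _
  have h := hm.corner_trivial (initial.to Z) p hZ.mem hp (Or.inr hw)
  rw [← pullback.lift_snd (eHomWhiskerRight SSet.{v} (initial.to Z) X)
    (eHomWhiskerLeft SSet.{v} Z p) (eHom_whisker_exchange SSet.{v} (initial.to Z) p).symm]
  exact (MorphismProperty.cancel_right_of_respectsIso
    (SSet.modelCategoryQuillen.I.{v}).rlp _ _).2 h

/-- Composition with a trivial cofibration is a trivial Kan fibration on mapping spaces into a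
fibrant object. -/
lemma IsSimplicialModel.trivialKanFibrations_whiskerRight {m : ModelCategory M}
    (hm : IsSimplicialModel m) {A B Z : M} (hZ : IsFibrantObj m Z) {i : A ⟶ B}
    (hi : cof m i) (hw : weq m i) :
    trivialKanFibrations (eHomWhiskerRight SSet.{v} i Z) := by
  let := m
  obtain ⟨hA⟩ := hm.nonempty_isTerminal_of_isTerminal terminalIsTerminal A
  obtain ⟨hB⟩ := hm.nonempty_isTerminal_of_isTerminal terminalIsTerminal B
  have : IsIso (eHomWhiskerRight SSet.{v} i (⊤_ M)) := isIso_of_isTerminal hB hA _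
  have h := hm.corner_trivial i (terminal.from Z) hi hZ.mem (Or.inl hw)
  rw [← pullback.lift_fst (eHomWhiskerRight SSet.{v} i Z)
    (eHomWhiskerLeft SSet.{v} B (terminal.from Z))
    (eHom_whisker_exchange SSet.{v} i (terminal.from Z)).symm]
  exact (MorphismProperty.cancel_right_of_respectsIso
    (SSet.modelCategoryQuillen.I.{v}).rlp _ _).2 h

lemma homEquiv'_comp_left {X Y Z : M} (f : X ⟶ Y) (g : Y ⟶ Z) :
    (eHomWhiskerLeft SSet.{v} X g).app _ (homEquiv' X Y f) = homEquiv' X Z (f ≫ g) := by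
  change _ = (eHomEquiv SSet.{v} (f ≫ g)).app _ PUnit.unit
  rw [eHomEquiv_comp]
  rfl

lemma homEquiv'_comp_right {X Y Z : M} (f : X ⟶ Y) (g : Y ⟶ Z) :
    (eHomWhiskerRight SSet.{v} f Z).app _ (homEquiv' Y Z g) = homEquiv' X Z (f ≫ g) := by
  change _ = (eHomEquiv SSet.{v} (f ≫ g)).app _ PUnit.unit
  rw [eHomEquiv_comp]
  rfl

lemma strictlyHomotopic_of_comp_right_eq {X Y Z : M} {p : Y ⟶ Z}
    (hp : trivialKanFibrations (eHomWhiskerLeft SSet.{v} X p)) {f g : X ⟶ Y}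
    (h : f ≫ p = g ≫ p) : StrictlyHomotopic f g :=
  exists_edge_of_trivialKanFibrations hp _ _ (by
    rw [homEquiv'_comp_left, homEquiv'_comp_left, h])

lemma strictlyHomotopic_of_comp_left_eq {X Y Z : M} {i : X ⟶ Y}
    (hi : trivialKanFibrations (eHomWhiskerRight SSet.{v} i Z)) {f g : Y ⟶ Z}
    (h : i ≫ f = i ≫ g) : StrictlyHomotopic f g :=
  exists_edge_of_trivialKanFibrations hi _ _ (by
    rw [homEquiv'_comp_right, homEquiv'_comp_right, h])

lemma homEquiv'_underlying_map {N : Type u'} [Category.{v} N] [SimplicialCategory N]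
    (T : EnrichedFunctor SSet.{v} M N) {X Y : M} (f : X ⟶ Y) :
    homEquiv' _ _ ((underlying T).map f) = (T.map X Y).app _ (homEquiv' X Y f) := by
  have h : eHomEquiv SSet.{v} ((underlying T).map f) = eHomEquiv SSet.{v} f ≫ T.map X Y :=
    (eHomEquiv SSet.{v}).apply_symm_apply _
  exact ConcreteCategory.congr_hom (NatTrans.congr_app h _) PUnit.unit

lemma StrictlyHomotopic.underlying_map {N : Type u'} [Category.{v} N] [SimplicialCategory N]
    (T : EnrichedFunctor SSet.{v} M N) {X Y : M} {f g : X ⟶ Y} (h : StrictlyHomotopic f g) :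
    StrictlyHomotopic ((underlying T).map f) ((underlying T).map g) := by
  obtain ⟨e, h₁, h₀⟩ := h
  refine ⟨(T.map X Y).app _ e, ?_, ?_⟩
  · rw [homEquiv'_underlying_map, ← h₁]
    exact (SSet.δ_naturality_apply (T.map X Y) _ e).symm
  · rw [homEquiv'_underlying_map, ← h₀]
    exact (SSet.δ_naturality_apply (T.map X Y) _ e).symm

lemma IdentifiesStrictlyHomotopic.underlying_comp {N : Type u'} [Category.{v} N]
    [SimplicialCategory N] {N' : Type u''} [Category.{v''} N'] {H : N ⥤ N'}
    (hH : IdentifiesStrictlyHomotopic H) (T : EnrichedFunctor SSet.{v} M N) :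
    IdentifiesStrictlyHomotopic (underlying T ⋙ H) :=
  fun _ _ _ _ h ↦ hH _ _ (h.underlying_map T)

section

variable {D : Type u''} [Category.{v''} D] {F : M ⥤ D} {m : ModelCategory M}

/-- Cofibrancy of `Y` gives a section of `p`; cofibrancy of `X` makes it an inverse up to strict
homotopy. -/
lemma IdentifiesStrictlyHomotopic.isIso_map_of_trivialFibration
    (hF : IdentifiesStrictlyHomotopic F) (hm : IsSimplicialModel m) {X Y : M}
    (hX : IsCofibrantObj m X) (hY : IsCofibrantObj m Y) {p : X ⟶ Y}
    (hp : fib m p) (hw : weq m p) : IsIso (F.map p) := by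
  let := m
  have : Fibration p := ⟨hp⟩
  have : WeakEquivalence p := ⟨hw⟩
  have : Cofibration (initial.to Y) := hY
  have sq : CommSq (initial.to X) (initial.to Y) p (𝟙 Y) := ⟨Subsingleton.elim _ _⟩
  refine ⟨F.map sq.lift, ?_, ?_⟩
  · rw [← F.map_comp, ← F.map_id]
    exact hF _ _ (strictlyHomotopic_of_comp_right_eq
      (hm.trivialKanFibrations_whiskerLeft hX hp hw) (by simp))
  · rw [← F.map_comp, sq.fac_right, F.map_id]

/-- Fibrancy of `X` gives a retraction of `i`; fibrancy of `Y` makes it an inverse up to strict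
homotopy. -/
lemma IdentifiesStrictlyHomotopic.isIso_map_of_trivialCofibration
    (hF : IdentifiesStrictlyHomotopic F) (hm : IsSimplicialModel m) {X Y : M}
    (hX : IsFibrantObj m X) (hY : IsFibrantObj m Y) {i : X ⟶ Y}
    (hi : cof m i) (hw : weq m i) : IsIso (F.map i) := by
  let := m
  have : Cofibration i := ⟨hi⟩
  have : WeakEquivalence i := ⟨hw⟩
  have : Fibration (terminal.from X) := hX
  have sq : CommSq (𝟙 X) i (terminal.from X) (terminal.from Y) := ⟨Subsingleton.elim _ _⟩
  refine ⟨F.map sq.lift, ?_, ?_⟩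
  · rw [← F.map_comp, sq.fac_left, F.map_id]
  · rw [← F.map_comp, ← F.map_id]
    exact hF _ _ (strictlyHomotopic_of_comp_left_eq
      (hm.trivialKanFibrations_whiskerRight hY hi hw) (by simp))

/-- A functor which identifies strictly homotopic maps inverts the weak equivalences between
bifibrant objects. -/
lemma IdentifiesStrictlyHomotopic.isIso_map_of_bifibrant
    (hF : IdentifiesStrictlyHomotopic F) (hm : IsSimplicialModel m) {X Y : M}
    (hX : IsCofibrantObj m X) (hX' : IsFibrantObj m X) (hY : IsCofibrantObj m Y)
    (hY' : IsFibrantObj m Y) {f : X ⟶ Y} (hf : weq m f) : IsIso (F.map f) := by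
  let := m
  have : IsCofibrant X := hX
  have : IsFibrant Y := hY'
  let d := MorphismProperty.factorizationData (trivialCofibrations M) (fibrations M) f
  obtain ⟨hi, hi'⟩ := (mem_trivialCofibrations_iff d.i).1 d.hi
  have : Fibration d.p := ⟨d.hp⟩
  have : WeakEquivalence f := ⟨hf⟩
  have hp : WeakEquivalence d.p := weakEquivalence_of_precomp_of_fac d.fac
  have hZ : IsCofibrant d.Z := isCofibrant_of_cofibration d.i
  have hZ' : IsFibrant d.Z := isFibrant_of_fibration d.p
  have := hF.isIso_map_of_trivialCofibration hm hX' hZ' hi.mem hi'.mem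
  have := hF.isIso_map_of_trivialFibration hm hZ hY d.hp hp.mem
  rw [← d.fac, F.map_comp]
  infer_instance

end

end Simplicial

/-! ### Comparison of the two model structures, and the conclusion -/

section Extension

variable {M : Type u} [Category.{v} M] {m mG : ModelCategory M}

/-- Trivial fibrations of a model structure are trivial fibrations of an extension. -/
lemma IsLLExtension.fib_and_weq (hext : IsLLExtension m mG) {X Y : M} {p : X ⟶ Y}
    (hp : fib m p) (hw : weq m p) : fib mG p ∧ weq mG p := by
  have h : (@trivialFibrations M _ mG.categoryWithFibrations mG.categoryWithWeakEquivalences) p := by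
    let := mG
    -- Trivial fibrations are determined by lifting against cofibrations, and the extension has
    -- fewer of these.
    rw [← cofibrations_rlp]
    intro A B i hi
    let := m
    have : Fibration p := ⟨hp⟩
    have : WeakEquivalence p := ⟨hw⟩
    have : Cofibration i := ⟨hext.cof_le _ hi⟩
    infer_instance
  exact h

/-- Cofibrant replacement by a trivial fibration. -/
lemma exists_cofibrant_replacement (m : ModelCategory M) (X : M) :
    ∃ (Q : M) (q : Q ⟶ X), IsCofibrantObj m Q ∧ fib m q ∧ weq m q := by
  let := m
  let d := MorphismProperty.factorizationData (cofibrations M) (trivialFibrations M) (initial.to X)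
  refine ⟨d.Z, d.p, ?_, d.hp.1, d.hp.2⟩
  have : Cofibration d.i := ⟨d.hi⟩
  exact (isCofibrant_iff_of_isInitial d.i initialIsInitial).2 this

end Extension

end LLExtension

theorem proposition2p1 {M : Type u} [Category.{v} M] [HasLimits M] [HasColimits M]
    (m mG : ModelCategory M) (hext : LLExtension.IsLLExtension m mG)
    (hcof : ∀ X : M, LLExtension.IsCofibrantObj mG X ↔ LLExtension.IsCofibrantObj m X)
    [SimplicialCategory M] (hsimp : LLExtension.IsSimplicialModel mG)
    {N : Type u'} [Category.{v} N] [SimplicialCategory N]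
    (T : EnrichedFunctor SSet.{v} M N)
    (hT : ∀ ⦃X Y : M⦄ (f : X ⟶ Y), LLExtension.IsFibrantObj m X → LLExtension.IsFibrantObj m Y →
      LLExtension.weq m f → IsIso ((LLExtension.underlying T).map f))
    {N' : Type u''} [Category.{v''} N'] (H : N ⥤ N')
    (hH : LLExtension.IdentifiesStrictlyHomotopic H) :
    ∀ ⦃X Y : M⦄ (f : X ⟶ Y), LLExtension.IsFibrantObj mG X → LLExtension.IsFibrantObj mG Y →
      LLExtension.weq mG f → IsIso ((LLExtension.underlying T ⋙ H).map f) := by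
  intro X Y f hX hY hf
  have toFibrant {Z : M} (hZ : LLExtension.IsFibrantObj mG Z) : LLExtension.IsFibrantObj m Z :=
    let := m
    ⟨hext.fib_le _ hZ.1⟩
  have replace {Z : M} (hZ : LLExtension.IsFibrantObj mG Z) : ∃ (Q : M) (q : Q ⟶ Z),
      LLExtension.IsCofibrantObj m Q ∧ LLExtension.fib m q ∧ LLExtension.weq m q ∧
      LLExtension.IsFibrantObj mG Q ∧ IsIso ((LLExtension.underlying T ⋙ H).map q) := by
    obtain ⟨Q, q, hQ, hq, hq'⟩ := LLExtension.exists_cofibrant_replacement m Z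
    have hQ' : LLExtension.IsFibrantObj mG Q := by
      let := mG
      have : Fibration q := ⟨(hext.fib_and_weq hq hq').1⟩
      have : IsFibrant Z := hZ
      exact isFibrant_of_fibration q
    -- The replacement lies in the smaller class of weak equivalences, so `T` itself inverts it,
    -- before `H` is applied.
    have := hT q (toFibrant hQ') (toFibrant hZ) hq'
    exact ⟨Q, q, hQ, hq, hq', hQ', inferInstanceAs (IsIso (H.map _))⟩
  obtain ⟨X', p, hX', hp, hpw, hXf, _⟩ := replace hX
  obtain ⟨Y', q, hY', hq, hqw, hYf, _⟩ := replace hY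
  obtain ⟨g, hg⟩ : ∃ g : X' ⟶ Y', g ≫ q = p ≫ f := by
    let := m
    have : Cofibration (initial.to X') := hX'
    have : Fibration q := ⟨hq⟩
    have : WeakEquivalence q := ⟨hqw⟩
    have sq : CommSq (initial.to Y') (initial.to X') q (p ≫ f) := ⟨Subsingleton.elim _ _⟩
    exact ⟨sq.lift, sq.fac_right⟩
  have hgw : LLExtension.weq mG g := by
    let := mG
    have : WeakEquivalence f := ⟨hf⟩
    have : WeakEquivalence p := ⟨hext.weq_le _ hpw⟩
    have : WeakEquivalence q := ⟨hext.weq_le _ hqw⟩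
    have : WeakEquivalence (g ≫ q) := by rw [hg]; infer_instance
    exact (weakEquivalence_of_postcomp g q).mem
  have := (hH.underlying_comp T).isIso_map_of_bifibrant hsimp ((hcof _).2 hX') hXf
    ((hcof _).2 hY') hYf hgw
  have hpf : IsIso ((LLExtension.underlying T ⋙ H).map p ≫
      (LLExtension.underlying T ⋙ H).map f) := by
    rw [← Functor.map_comp, ← hg, Functor.map_comp]
    infer_instance
  exact IsIso.of_isIso_comp_left ((LLExtension.underlying T ⋙ H).map p) _
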